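/- Let $n=2k$ be even. The affine group $\mathrm{Aff}(\mathbb{Z}_{n})=\mathbb{Z}_{n}\rtimes\mathbb{Z}_{n}^{\times}$ acts on $\mathbb{Z}_{n}$ by $e^{u}.v\,(x)=vx+u$, hence on the subsets of $\mathbb{Z}_{n}$. A strong dichotomy of $\mathbb{Z}_{n}$ is a $k$-element subset $X\subseteq\mathbb{Z}_{n}$ that is self-complementary (its complement lies in its $\mathrm{Aff}(\mathbb{Z}_{n})$-orbit) and rigid (only the identity of $\mathrm{Aff}(\mathbb{Z}_{n})$ maps $X$ onto itself). A strong dichotomy pattern is the $\mathrm{Aff}(\mathbb{Z}_{n})$-orbit of a strong dichotomy. The polarity of a strong dichotomy $X$ is the unique $p\in\mathrm{Aff}(\mathbb{Z}_{n})$ with $p(X)=\mathbb{Z}_{n}\setminus X$. The polarities of the members of a strong dichotomy pattern form a conjugacy class of $\mathrm{Aff}(\mathbb{Z}_{n})$, called the polarity of the pattern. For each of the following values of $2k$, the number of strong dichotomy patterns of $\mathbb{Z}_{2k}$ is the total given below. In each row the summands, in some order, are the numbers of strong dichotomy patterns with a given polarity, one summand for each polarity that occurs. $$ \begin{array}{c|l}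 2k & \text{number of strong dichotomy patterns}\\ \hline 6 & 1\\ 8 & 1\\ 12 & 2+4=6\\ 16 & 1+14=15\\ 20 & 3+6+54+27=90\\ 24 & 14+54+63+228=359\\ 28 & 38+76+326+652=1092\\ 32 & 120+2032=2152\\ 36 & 560+1120+5382+10764=17826\\ 40 & 1572+6357+8100+32520=48549\\ 42 & 3936+12135+28320+86448=130839\\ 44 & 4662+9324+52278+104556=170820\\ 48 & 21435+65040+172410+521760=780645 \end{array} $$ For $2k=8$, the polarity of the single pattern is the conjugacy class of $e^{5}.-1$. -/

import Mathlib

open scoped Pointwise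

namespace StrongDichotomy

/-- The units of `ℤ_n` act on the additive group of `ℤ_n` by multiplication. -/
def unitsHom (n : ℕ) : (ZMod n)ˣ →* MulAut (Multiplicative (ZMod n)) :=
  (MulAutMultiplicative (ZMod n)).symm.toMonoidHom.comp
    (DistribMulAction.toAddAut (ZMod n)ˣ (ZMod n))

theorem toAdd_unitsHom {n : ℕ} (v : (ZMod n)ˣ) (x : Multiplicative (ZMod n)) :
    Multiplicative.toAdd (unitsHom n v x) = (v : ZMod n) * Multiplicative.toAdd x := rfl

/-- The affine group `Aff(ℤ_n) = ℤ_n ⋊ ℤ_n^×`, the units acting on `ℤ_n` by multiplication. -/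
abbrev Aff (n : ℕ) : Type :=
  Multiplicative (ZMod n) ⋊[unitsHom n] (ZMod n)ˣ

/-- The element `e^u.v` of `Aff(ℤ_n)`. -/
def Aff.mk {n : ℕ} (u : ZMod n) (v : (ZMod n)ˣ) : Aff n :=
  ⟨Multiplicative.ofAdd u, v⟩

/-- `Aff(ℤ_n)` acts on `ℤ_n` by `e^u.v (x) = v * x + u`. -/
instance Aff.mulAction (n : ℕ) : MulAction (Aff n) (ZMod n) where
  smul g x := (g.right : ZMod n) * x + Multiplicative.toAdd g.left
  one_smul x := by
    change ((1 : Aff n).right : ZMod n) * x + Multiplicative.toAdd (1 : Aff n).left = x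
    simp
  mul_smul g h x := by
    change ((g * h).right : ZMod n) * x + Multiplicative.toAdd (g * h).left =
      (g.right : ZMod n) * ((h.right : ZMod n) * x + Multiplicative.toAdd h.left) +
        Multiplicative.toAdd g.left
    rw [SemidirectProduct.mul_right, SemidirectProduct.mul_left, toAdd_mul, Units.val_mul,
      toAdd_unitsHom]
    ring

theorem Aff.mk_smul {n : ℕ} (u : ZMod n) (v : (ZMod n)ˣ) (x : ZMod n) :
    Aff.mk u v • x = (v : ZMod n) * x + u := rfl

instance Aff.finite (n : ℕ) [NeZero n] : Finite (Aff n) :=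
  Finite.of_equiv _ SemidirectProduct.equivProd.symm

section

variable {n : ℕ} [NeZero n]

/-- A dichotomy of `ℤ_n`, with `n = 2k`, is a subset with `k` elements. -/
def IsDichotomy (X : Finset (ZMod n)) : Prop :=
  2 * X.card = n

/-- The complement of `X` lies in the orbit of `X` under `Aff(ℤ_n)`. -/
def IsSelfComplementary (X : Finset (ZMod n)) : Prop :=
  Xᶜ ∈ MulAction.orbit (Aff n) X

/-- Only the identity of `Aff(ℤ_n)` maps `X` onto itself. -/
def IsRigid (X : Finset (ZMod n)) : Prop :=
  MulAction.stabilizer (Aff n) X = ⊥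

/-- A strong dichotomy is a self-complementary and rigid one. -/
def IsStrong (X : Finset (ZMod n)) : Prop :=
  IsDichotomy X ∧ IsSelfComplementary X ∧ IsRigid X

/-- `p` is a polarity of `X` if `p` maps `X` onto its complement, that is, if `p` composed with
the exchange of the two colours leaves the colouring given by `X` and its complement invariant. -/
def IsPolarity (p : Aff n) (X : Finset (ZMod n)) : Prop :=
  p • X = Xᶜ

/-- A strong dichotomy has one and only one polarity. -/
theorem IsStrong.existsUnique_polarity {X : Finset (ZMod n)} (hX : IsStrong X) :
    ∃! p : Aff n, IsPolarity p X := by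
  obtain ⟨-, ⟨p, hp⟩, hr⟩ := hX
  refine ⟨p, hp, fun q hq => ?_⟩
  have h1 : p⁻¹ * q ∈ MulAction.stabilizer (Aff n) X := by
    rw [MulAction.mem_stabilizer_iff, mul_smul, inv_smul_eq_iff]
    exact Eq.trans hq (Eq.symm hp)
  rw [hr, Subgroup.mem_bot] at h1
  exact (inv_mul_eq_one.mp h1).symm

/-- The polarity of a translate `g • X` is the conjugate by `g` of the polarity of `X`. -/
theorem IsPolarity.smul {p : Aff n} {X : Finset (ZMod n)} (h : IsPolarity p X) (g : Aff n) :
    IsPolarity (g * p * g⁻¹) (g • X) := by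
  have h2 : g • Xᶜ = (g • X)ᶜ := by
    apply Finset.coe_injective
    push_cast
    exact Set.smul_set_compl
  rw [IsPolarity, mul_smul, inv_smul_smul, mul_smul, h, h2]

end

/-- The patterns of `ℤ_n`: the orbits of the subsets of `ℤ_n` under `Aff(ℤ_n)`. -/
abbrev Pattern (n : ℕ) [NeZero n] : Type :=
  MulAction.orbitRel.Quotient (Aff n) (Finset (ZMod n))

/-- The pattern of a subset of `ℤ_n`. -/
def pattern {n : ℕ} [NeZero n] (X : Finset (ZMod n)) : Pattern n :=
  Quotient.mk (MulAction.orbitRel (Aff n) (Finset (ZMod n))) X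

/-- The strong dichotomy patterns of `ℤ_n`: the orbits of the strong dichotomies. -/
def strongPatterns (n : ℕ) [NeZero n] : Set (Pattern n) :=
  {P | ∃ X : Finset (ZMod n), IsStrong X ∧ pattern X = P}

/-- The strong dichotomy patterns with polarity in the conjugacy class `c`. The polarities of the
members of one pattern form a conjugacy class of `Aff(ℤ_n)`. -/
def strongPatternsWithPolarity (n : ℕ) [NeZero n] (c : ConjClasses (Aff n)) :
    Set (Pattern n) :=
  {P | ∃ X : Finset (ZMod n), IsStrong X ∧ pattern X = P ∧
    ∃ p : Aff n, IsPolarity p X ∧ ConjClasses.mk p = c}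

/-- The polarities, up to conjugacy, of the strong dichotomies of `ℤ_n`. -/
def polarities (n : ℕ) [NeZero n] : Set (ConjClasses (Aff n)) :=
  {c | ∃ X : Finset (ZMod n), IsStrong X ∧ ∃ p : Aff n, IsPolarity p X ∧ ConjClasses.mk p = c}

/-- The number of strong dichotomy patterns of `ℤ_n`. -/
noncomputable def strongCount (n : ℕ) [NeZero n] : ℕ :=
  (strongPatterns n).ncard

/-- The numbers of strong dichotomy patterns of `ℤ_n` with a given polarity, one entry for each
polarity, as a multiset. -/
noncomputable def polarityCounts (n : ℕ) [NeZero n] : Multiset ℕ :=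
  (polarities n).toFinite.toFinset.val.map fun c => (strongPatternsWithPolarity n c).ncard

end StrongDichotomy

/-! If `X` is rigid with polarity `p`, then `p * p` preserves `X` and is therefore trivial, and `p`
has no fixed point. Conversely, for a fixed-point-free involution `p` of `ℤ_{2k}`, a set with
polarity `p` is a choice of one point from each of the `k` two-cycles of `p`, so there are `2 ^ k`
of them. The centralizer of `p` acts freely on the rigid ones, and its orbits correspond to the
patterns whose polarity is the class of `p` (`ncard_strongPatternsWithPolarity`). The number of
these patterns is thus `(2 ^ k - b) / |C(p)|`, where `b` counts the non-rigid sets with polarity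
`p`.

To find `b`, note that conjugation by `p` is an involutive automorphism of the stabilizer of `X`.
Either it fixes a nontrivial element or it is inversion, so a non-rigid `X` has a nontrivial
symmetry that `p` fixes or inverts (`exists_fixed_or_inverted`). A power of it has prime order, and
the primes dividing `n * φ(n)` are at most 11. The non-rigid sets are therefore a union, over a
short list of maps `g`, of the families of `g`-invariant sets with polarity `p`
(`sat_nonrigidFamilies`). Such a family is given by two-coloured blocks; a partition into `m` blocks
has `2 ^ m` solutions (`card_solutions`). Intersections are again given by blocks or are empty, and
the union is counted by applying `|W ∪ R| = |W| - |W ∩ R| + |R|` recursively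
(`card_unionSolutions`).

Conjugate affine maps have the same linear part, which separates the listed classes; that the list
is exhaustive is a finite check. `counts_of_check` assembles these facts. Only successful
evaluations are used: a `none` or `false` makes the check fail, so neither sufficiency of the depth
bound nor that `meet` yields partitions has to be proved. -/

namespace StrongDichotomy

set_option linter.unusedSectionVars false

/-! ### Two-coloured partitions

The computations below are evaluated by the kernel, so they are phrased with recursors and with the
binary representation of natural numbers. A block `(A, B)` of bit masks is the constraint that a
predicate is constant on the bits of `A` and takes the opposite value on the bits of `B`. -/

/-- `P` is constant on the bits of `b.1` and takes the opposite value on the bits of `b.2`. -/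
def Holds (P : ℕ → Prop) (b : ℕ × ℕ) : Prop :=
  ∃ t : Prop, ∀ i, (b.1.testBit i = true → (P i ↔ t)) ∧ (b.2.testBit i = true → (P i ↔ ¬t))

/-- `P` satisfies all constraints in the list. -/
def Sat (P : ℕ → Prop) (V : List (ℕ × ℕ)) : Prop :=
  ∀ b ∈ V, Holds P b

/-- Merge the block `(A, B)` with all blocks of `L` that meet `C`, keeping the others in front of
`K`; `none` if the constraints are contradictory. -/
noncomputable def mergeInto (C : ℕ) (L : List (ℕ × ℕ)) :
    ℕ → ℕ → List (ℕ × ℕ) → Option (List (ℕ × ℕ)) :=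
  List.rec (motive := fun _ => ℕ → ℕ → List (ℕ × ℕ) → Option (List (ℕ × ℕ)))
    (fun A B K => Bool.rec none (some ((A, B) :: K)) (Nat.beq (Nat.land A B) 0))
    (fun b _ ih A B K => Prod.rec (fun a b =>
      Bool.rec (ih (Nat.lor A a) (Nat.lor B b) K)
        (Bool.rec (ih (Nat.lor A b) (Nat.lor B a) K) (ih A B ((a, b) :: K))
          (Nat.beq (Nat.land b C) 0))
        (Nat.beq (Nat.land a C) 0)) b) L

/-- Add the constraints `U` to the partition `W`; `none` if they are contradictory. -/
noncomputable def meet (U : List (ℕ × ℕ)) : List (ℕ × ℕ) → Option (List (ℕ × ℕ)) :=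
  List.rec (motive := fun _ => List (ℕ × ℕ) → Option (List (ℕ × ℕ))) some
    (fun b _ ih W => Prod.rec (fun a b => Option.rec none ih (mergeInto a W a b [])) b) U

/-- The blocks of `L` and the bits of `acc` partition `{0, …, n - 1}`. -/
noncomputable def isPartition (n : ℕ) (L : List (ℕ × ℕ)) : ℕ → Bool :=
  List.rec (motive := fun _ => ℕ → Bool) (fun acc => Nat.beq acc (2 ^ n - 1))
    (fun b _ ih acc => Prod.rec (fun a b =>
      Bool.rec false (Bool.rec false (Bool.rec (ih (Nat.lor acc (Nat.lor a b))) false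
        (Nat.beq (Nat.lor a b) 0)) (Nat.beq (Nat.land a b) 0))
        (Nat.beq (Nat.land acc (Nat.lor a b)) 0)) b) L

/-- The traces on `W` of the members of a family of partitions; `none` if `W` is recognized to be
contained in one of them. -/
noncomputable def restrict (n : ℕ) (W : List (ℕ × ℕ)) (l : List (List (ℕ × ℕ))) :
    Option (List (List (ℕ × ℕ))) :=
  List.rec (some []) (fun U _ ih => Option.rec ih (fun J =>
      Bool.rec (Option.rec none (fun S => some (J :: S)) ih) none
        (Nat.beq J.length W.length && isPartition n J 0 && isPartition n W 0)) (meet U W)) l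

/-- The number of predicates on `{0, …, n - 1}` that satisfy the constraints of some member of
a family. The first explicit argument bounds the depth of the recursion. -/
noncomputable def unionCount (n k : ℕ) : List (List (ℕ × ℕ)) → Option ℕ :=
  Nat.rec (fun _ => none) (fun _ f l => List.rec (some 0)
    (fun W Us ih => Option.rec ih (fun S => Bool.rec none
      (Option.rec none (fun a => Option.rec none (fun b => some (2 ^ W.length - a + b)) ih) (f S))
      (isPartition n W 0)) (restrict n W Us)) l) k

/-! ### Correctness of merging constraints -/

theorem sat_nil (P : ℕ → Prop) : Sat P [] := by simp [Sat]

theorem sat_cons {P : ℕ → Prop} {b : ℕ × ℕ} {V : List (ℕ × ℕ)} :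
    Sat P (b :: V) ↔ Holds P b ∧ Sat P V := by simp [Sat]

theorem holds_swap {P : ℕ → Prop} {a b : ℕ} : Holds P (a, b) ↔ Holds P (b, a) := by
  have key : ∀ {a b : ℕ}, Holds P (a, b) → Holds P (b, a) := by
    rintro a b ⟨t, ht⟩
    exact ⟨¬t, fun i => ⟨(ht i).2, fun h => by rw [(ht i).1 h, not_not]⟩⟩
  exact ⟨key, key⟩

theorem testBit_land (a b i : ℕ) :
    (Nat.land a b).testBit i = (a.testBit i && b.testBit i) := Nat.testBit_and a b i

theorem testBit_lor (a b i : ℕ) :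
    (Nat.lor a b).testBit i = (a.testBit i || b.testBit i) := Nat.testBit_or a b i

theorem exists_common_bit {a b : ℕ} (h : Nat.beq (Nat.land a b) 0 = false) :
    ∃ i, a.testBit i = true ∧ b.testBit i = true := by
  by_contra! hc
  have : Nat.land a b = 0 := Nat.eq_of_testBit_eq fun i => by
    rw [testBit_land, Nat.zero_testBit]
    have := hc i
    cases h1 : a.testBit i <;> simp_all
  rw [this] at h
  exact absurd h (by decide)

/-- The common bit `i` forces the truth values of the two blocks to agree, so both constraints
amount to one. -/
theorem holds_merge {P : ℕ → Prop} {A B a b i : ℕ} (hA : A.testBit i = true)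
    (ha : a.testBit i = true) :
    Holds P (Nat.lor A a, Nat.lor B b) ↔ Holds P (A, B) ∧ Holds P (a, b) := by
  simp only [Holds, testBit_lor, Bool.or_eq_true]
  constructor
  · rintro ⟨t, ht⟩
    exact ⟨⟨t, fun j => ⟨fun h => (ht j).1 (.inl h), fun h => (ht j).2 (.inl h)⟩⟩,
      ⟨t, fun j => ⟨fun h => (ht j).1 (.inr h), fun h => (ht j).2 (.inr h)⟩⟩⟩
  · rintro ⟨⟨t, ht⟩, s, hs⟩
    have hst : s ↔ t := ((hs i).1 ha).symm.trans ((ht i).1 hA)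
    refine ⟨t, fun j => ⟨?_, ?_⟩⟩
    · rintro (h | h)
      · exact (ht j).1 h
      · rw [← hst]; exact (hs j).1 h
    · rintro (h | h)
      · exact (ht j).2 h
      · rw [← hst]; exact (hs j).2 h

theorem mergeInto_cons (C a b : ℕ) (L : List (ℕ × ℕ)) (A B : ℕ) (K : List (ℕ × ℕ)) :
    mergeInto C ((a, b) :: L) A B K =
      bif Nat.beq (Nat.land a C) 0 then
        bif Nat.beq (Nat.land b C) 0 then mergeInto C L A B ((a, b) :: K)
        else mergeInto C L (Nat.lor A b) (Nat.lor B a) K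
      else mergeInto C L (Nat.lor A a) (Nat.lor B b) K := by
  change Bool.rec (motive := fun _ => Option (List (ℕ × ℕ))) _ (Bool.rec
    (motive := fun _ => Option (List (ℕ × ℕ))) _ _ (Nat.beq (Nat.land b C) 0))
    (Nat.beq (Nat.land a C) 0) = _
  cases Nat.beq (Nat.land a C) 0 <;> cases Nat.beq (Nat.land b C) 0 <;> rfl

/-- The invariant `C ⊆ A` places every bit shared with `C` in the growing block, so `holds_merge`
applies, after swapping colours if it is `b` that meets `C`. The blocks need not be disjoint. -/
theorem sat_mergeInto {P : ℕ → Prop} {C : ℕ} (L : List (ℕ × ℕ)) (A B : ℕ) (K : List (ℕ × ℕ))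
    (hC : ∀ i, C.testBit i = true → A.testBit i = true) :
    (Sat P L ∧ Holds P (A, B) ∧ Sat P K) ↔ ∃ r, mergeInto C L A B K = some r ∧ Sat P r := by
  induction L generalizing A B K with
  | nil =>
    have hnil : mergeInto C [] A B K =
        bif Nat.beq (Nat.land A B) 0 then some ((A, B) :: K) else none := by
      change Bool.rec (motive := fun _ => Option (List (ℕ × ℕ))) _ _
        (Nat.beq (Nat.land A B) 0) = _
      cases Nat.beq (Nat.land A B) 0 <;> rfl
    rw [hnil]
    cases h : Nat.beq (Nat.land A B) 0
    · obtain ⟨i, h1, h2⟩ := exists_common_bit h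
      -- A point in both `A` and `B` would have to take both colours.
      simp only [cond_false, reduceCtorEq, false_and, exists_false, iff_false]
      rintro ⟨-, ⟨t, ht⟩, -⟩
      have h3 := (ht i).1 h1
      have h4 := (ht i).2 h2
      tauto
    · simp [sat_cons, sat_nil]
  | cons b L ih =>
    obtain ⟨a, b⟩ := b
    rw [mergeInto_cons]
    cases h1 : Nat.beq (Nat.land a C) 0
    · obtain ⟨i, hi, hi'⟩ := exists_common_bit h1
      rw [cond_false, ← ih _ _ _ fun j hj => by rw [testBit_lor, hC j hj, Bool.true_or],
        holds_merge (hC i hi') hi, sat_cons]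
      tauto
    · rw [cond_true]
      cases h2 : Nat.beq (Nat.land b C) 0
      · obtain ⟨i, hi, hi'⟩ := exists_common_bit h2
        rw [cond_false, ← ih _ _ _ fun j hj => by rw [testBit_lor, hC j hj, Bool.true_or],
          holds_merge (hC i hi') hi, sat_cons, holds_swap (a := a)]
        tauto
      · rw [cond_true, ← ih _ _ _ hC, sat_cons, sat_cons]
        tauto

theorem sat_meet {P : ℕ → Prop} (U W : List (ℕ × ℕ)) :
    (Sat P U ∧ Sat P W) ↔ ∃ r, meet U W = some r ∧ Sat P r := by
  induction U generalizing W with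
  | nil =>
    change _ ↔ ∃ r, some W = some r ∧ _
    simp [sat_nil]
  | cons b U ih =>
    obtain ⟨a, b⟩ := b
    have h := sat_mergeInto (P := P) W a b [] (fun _ hi => hi)
    change _ ↔ ∃ r, Option.rec none (meet U) (mergeInto a W a b []) = some r ∧ _
    rw [sat_cons, and_assoc, and_left_comm, show (Holds P (a, b) ∧ Sat P W) ↔ _ from
      ⟨fun hh => h.1 ⟨hh.2, hh.1, sat_nil P⟩, fun hh => ⟨(h.2 hh).2.1, (h.2 hh).1⟩⟩]
    cases hm : mergeInto a W a b [] with
    | none => simp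
    | some r => simpa using ih r

theorem sat_of_meet {P : ℕ → Prop} {U W r : List (ℕ × ℕ)} (h : meet U W = some r) :
    Sat P r ↔ Sat P U ∧ Sat P W := by
  rw [sat_meet, h]
  simp

theorem not_sat_of_meet {P : ℕ → Prop} {U W : List (ℕ × ℕ)} (h : meet U W = none) :
    ¬(Sat P U ∧ Sat P W) := by
  rw [sat_meet, h]
  simp

/-- The bits of a natural number. -/
def bits (a : ℕ) : Finset ℕ := (Finset.range a).filter fun i => a.testBit i = true

theorem mem_bits {a i : ℕ} : i ∈ bits a ↔ a.testBit i = true := by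
  simp only [bits, Finset.mem_filter, Finset.mem_range, and_iff_right_iff_imp]
  exact fun h => (Nat.lt_two_pow_self).trans_le (Nat.ge_two_pow_of_testBit h)

theorem bits_lor (a b : ℕ) : bits (Nat.lor a b) = bits a ∪ bits b := by
  ext i
  rw [mem_bits, testBit_lor, Bool.or_eq_true, Finset.mem_union, mem_bits, mem_bits]

theorem bits_disjoint {a b : ℕ} (h : Nat.beq (Nat.land a b) 0 = true) :
    Disjoint (bits a) (bits b) := by
  rw [Finset.disjoint_left]
  intro i hi hi'
  rw [mem_bits] at hi hi'
  have h0 : (Nat.land a b).testBit i = true := by rw [testBit_land, hi, hi']; rfl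
  rw [Nat.eq_of_beq_eq_true h, Nat.zero_testBit] at h0
  exact absurd h0 (by decide)

theorem bits_two_pow_sub_one (n : ℕ) : bits (2 ^ n - 1) = Finset.range n := by
  ext i
  simp [mem_bits, Nat.testBit_two_pow_sub_one]

/-! ### Counting the solutions of a partition -/

theorem isPartition_cons {n a b acc : ℕ} {L : List (ℕ × ℕ)}
    (h : isPartition n ((a, b) :: L) acc = true) :
    Disjoint (bits acc) (bits (Nat.lor a b)) ∧ Disjoint (bits a) (bits b) ∧ Nat.lor a b ≠ 0 ∧
      isPartition n L (Nat.lor acc (Nat.lor a b)) = true := by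
  change Bool.rec false (Bool.rec false (Bool.rec (isPartition n L _) false _) _) _ = true at h
  cases h1 : Nat.beq (Nat.land acc (Nat.lor a b)) 0 with
  | false => rw [h1] at h; exact absurd h Bool.false_ne_true
  | true =>
    cases h2 : Nat.beq (Nat.land a b) 0 with
    | false => rw [h1, h2] at h; exact absurd h Bool.false_ne_true
    | true =>
      cases h3 : Nat.beq (Nat.lor a b) 0 with
      | true => rw [h1, h2, h3] at h; exact absurd h Bool.false_ne_true
      | false =>
        rw [h1, h2, h3] at h
        exact ⟨bits_disjoint h1, bits_disjoint h2,
          fun h0 => by rw [h0] at h3; exact absurd h3 (by decide), h⟩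

theorem bits_subset_of_isPartition {n acc : ℕ} {L : List (ℕ × ℕ)}
    (h : isPartition n L acc = true) : bits acc ⊆ Finset.range n := by
  induction L generalizing acc with
  | nil =>
    change Nat.beq acc (2 ^ n - 1) = true at h
    rw [Nat.eq_of_beq_eq_true h, bits_two_pow_sub_one]
  | cons b L ih =>
    have := ih (isPartition_cons h).2.2.2
    rw [bits_lor] at this
    exact Finset.union_subset_left this

open Classical in
/-- The subsets of `{0, …, n - 1}` whose membership predicate satisfies the constraints. -/
noncomputable def solutions (n : ℕ) (V : List (ℕ × ℕ)) : Finset (Finset ℕ) :=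
  (Finset.range n).powerset.filter fun s => Sat (· ∈ s) V

theorem mem_solutions {n : ℕ} {V : List (ℕ × ℕ)} {s : Finset ℕ} :
    s ∈ solutions n V ↔ s ⊆ Finset.range n ∧ Sat (· ∈ s) V := by
  simp [solutions]

theorem holds_congr {P Q : ℕ → Prop} {b : ℕ × ℕ}
    (h : ∀ i, b.1.testBit i = true ∨ b.2.testBit i = true → (P i ↔ Q i)) :
    Holds P b ↔ Holds Q b := by
  constructor <;> rintro ⟨t, ht⟩ <;> refine ⟨t, fun i => ⟨fun hi => ?_, fun hi => ?_⟩⟩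
  · rw [← h i (.inl hi)]; exact (ht i).1 hi
  · rw [← h i (.inr hi)]; exact (ht i).2 hi
  · rw [h i (.inl hi)]; exact (ht i).1 hi
  · rw [h i (.inr hi)]; exact (ht i).2 hi

theorem holds_mem_iff {a b : ℕ} {s : Finset ℕ} (hd : Disjoint (bits a) (bits b)) :
    Holds (· ∈ s) (a, b) ↔ s ∩ bits (Nat.lor a b) = bits a ∨ s ∩ bits (Nat.lor a b) = bits b := by
  rw [Finset.disjoint_left] at hd
  simp only [bits_lor, Finset.ext_iff, Finset.mem_inter, Finset.mem_union, Holds]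
  simp only [← mem_bits]
  constructor
  · rintro ⟨t, ht⟩
    by_cases h : t
    · left; intro i; have := ht i; have := @hd i; tauto
    · right; intro i; have := ht i; have := @hd i; tauto
  · rintro (h | h)
    · exact ⟨True, fun i => by have := h i; have := @hd i; tauto⟩
    · exact ⟨False, fun i => by have := h i; have := @hd i; tauto⟩

open Classical in
-- Each block doubles the count: on its support a solution is either `bits a` or `bits b`,
-- independently of the rest. The mask `acc` records the points used by earlier blocks, which makes
-- the induction possible.
theorem card_filter_sat {n acc : ℕ} {L : List (ℕ × ℕ)} (h : isPartition n L acc = true) :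
    ((Finset.range n \ bits acc).powerset.filter fun s => Sat (· ∈ s) L).card = 2 ^ L.length := by
  induction L generalizing acc with
  | nil =>
    change Nat.beq acc (2 ^ n - 1) = true at h
    rw [Nat.eq_of_beq_eq_true h, bits_two_pow_sub_one]
    simp [sat_nil]
  | cons b L ih =>
    obtain ⟨a, b⟩ := b
    obtain ⟨h1, h2, h3, h4⟩ := isPartition_cons h
    have hsub := bits_subset_of_isPartition h4
    rw [bits_lor] at hsub
    have ih' := ih h4
    rw [bits_lor] at ih'
    set T := bits (Nat.lor a b) with hT
    -- The two colourings of a block differ because the block is nonempty and its halves are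
    -- disjoint.
    have hab : bits a ≠ bits b := by
      intro hab
      have h0 : bits a = ∅ := by rw [← hab, disjoint_self] at h2; exact h2
      apply h3
      refine Nat.eq_of_testBit_eq fun i => ?_
      have : i ∉ T := by rw [hT, bits_lor, ← hab, h0]; simp
      rw [hT, mem_bits, Bool.not_eq_true] at this
      rw [this, Nat.zero_testBit]
    have haT : bits a ⊆ T := by rw [hT, bits_lor]; exact Finset.subset_union_left
    have hbT : bits b ⊆ T := by rw [hT, bits_lor]; exact Finset.subset_union_right
    -- The later blocks avoid `T`, so their constraints do not see the colouring chosen there.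
    have hLT : ∀ b' ∈ L, ∀ i, b'.1.testBit i = true ∨ b'.2.testBit i = true → i ∉ T := by
      have aux : ∀ (L : List (ℕ × ℕ)) (acc : ℕ), isPartition n L acc = true →
          ∀ b' ∈ L, ∀ i, b'.1.testBit i = true ∨ b'.2.testBit i = true → i ∉ bits acc := by
        intro L
        induction L with
        | nil => simp
        | cons c L ihL =>
          intro acc hacc b' hb' i hi
          obtain ⟨g1, -, -, g4⟩ := isPartition_cons hacc
          rcases List.mem_cons.1 hb' with rfl | hb'
          · intro hia
            refine Finset.disjoint_left.1 g1 hia ?_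
            rw [mem_bits, testBit_lor]
            rcases hi with hi | hi <;> simp [hi]
          · intro hia
            refine ihL _ g4 b' hb' i hi ?_
            rw [bits_lor]
            exact Finset.mem_union_left _ hia
      intro b' hb' i hi hiT
      refine aux L _ h4 b' hb' i hi ?_
      rw [bits_lor]
      exact Finset.mem_union_right _ hiT
    have key : ((Finset.range n \ bits acc).powerset.filter fun s => Sat (· ∈ s) ((a, b) :: L)) =
        (({bits a, bits b} : Finset (Finset ℕ)) ×ˢ
          ((Finset.range n \ (bits acc ∪ T)).powerset.filter fun s => Sat (· ∈ s) L)).image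
            fun x => x.1 ∪ x.2 := by
      ext s
      simp only [Finset.mem_filter, Finset.mem_powerset, Finset.mem_image, Finset.mem_product,
        Finset.mem_insert, Finset.mem_singleton, Prod.exists, sat_cons]
      constructor
      · rintro ⟨hs, hh, hL⟩
        refine ⟨s ∩ T, s \ T, ⟨(holds_mem_iff h2).1 hh, ?_, fun b' hb' => ?_⟩, ?_⟩
        · intro i hi
          have h5 := Finset.mem_sdiff.1 hi
          have h6 := Finset.mem_sdiff.1 (hs h5.1)
          simp only [Finset.mem_sdiff, Finset.mem_union]
          tauto
        · refine (holds_congr fun i hi => ?_).1 (hL b' hb')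
          simp [hLT b' hb' i hi]
        · rw [Finset.union_comm]; exact Finset.sdiff_union_inter s T
      · rintro ⟨t, s', ⟨ht, hs', hL⟩, rfl⟩
        have htT : t ⊆ T := by rcases ht with rfl | rfl <;> assumption
        have hs'T : ∀ i ∈ s', i ∉ T := fun i hi => by
          have := Finset.mem_sdiff.1 (hs' hi)
          simp only [Finset.mem_union] at this
          tauto
        refine ⟨?_, ?_, fun b' hb' => ?_⟩
        · intro i hi
          rw [Finset.mem_sdiff]
          rcases Finset.mem_union.1 hi with hi | hi
          · exact ⟨hsub (Finset.mem_union_right _ (htT hi)),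
              fun hia => Finset.disjoint_left.1 h1 hia (htT hi)⟩
          · have := Finset.mem_sdiff.1 (hs' hi)
            simp only [Finset.mem_union] at this
            tauto
        · rw [holds_mem_iff h2]
          have : (t ∪ s') ∩ T = t := by
            ext i
            simp only [Finset.mem_inter, Finset.mem_union]
            have := hs'T i
            have := @htT i
            tauto
          rw [this]
          exact ht
        · refine (holds_congr fun i hi => ?_).1 (hL b' hb')
          have h5 := hLT b' hb' i hi
          have h6 : i ∉ t := fun h => h5 (htT h)
          simp [h6]
    rw [key, Finset.card_image_of_injOn, Finset.card_product, ih', Finset.card_pair hab,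
      List.length_cons, pow_succ, mul_comm]
    rintro ⟨t, s⟩ hx ⟨t', s'⟩ hx' heq
    simp only [Finset.coe_product, Set.mem_prod, Finset.mem_coe, Finset.mem_insert,
      Finset.mem_singleton, Finset.mem_filter, Finset.mem_powerset] at hx hx' heq
    have htT : t ⊆ T := by rcases hx.1 with h | h <;> rw [h] <;> assumption
    have htT' : t' ⊆ T := by rcases hx'.1 with h | h <;> rw [h] <;> assumption
    have hsT : ∀ i ∈ s, i ∉ T := fun i hi => by
      have := Finset.mem_sdiff.1 (hx.2.1 hi)
      simp only [Finset.mem_union] at this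
      tauto
    have hsT' : ∀ i ∈ s', i ∉ T := fun i hi => by
      have := Finset.mem_sdiff.1 (hx'.2.1 hi)
      simp only [Finset.mem_union] at this
      tauto
    have inter_eq : ∀ {t s : Finset ℕ}, t ⊆ T → (∀ i ∈ s, i ∉ T) →
        (t ∪ s) ∩ T = t ∧ (t ∪ s) \ T = s := by
      intro t s ht hs
      constructor <;> ext i <;> simp only [Finset.mem_inter, Finset.mem_sdiff, Finset.mem_union] <;>
        have g1 := @ht i <;> have g2 := hs i <;> tauto
    obtain ⟨e1, e2⟩ := inter_eq htT hsT
    obtain ⟨e1', e2'⟩ := inter_eq htT' hsT'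
    rw [heq] at e1 e2
    rw [← e1, ← e2, e1', e2']

theorem card_solutions {n : ℕ} {V : List (ℕ × ℕ)} (h : isPartition n V 0 = true) :
    (solutions n V).card = 2 ^ V.length := by
  have := card_filter_sat h
  rw [show bits 0 = ∅ from rfl, Finset.sdiff_empty] at this
  exact this

/-! ### Inclusion and exclusion for unions of families -/

theorem sat_union_restrict {n : ℕ} {W : List (ℕ × ℕ)} {l S : List (List (ℕ × ℕ))}
    (h : restrict n W l = some S) (P : ℕ → Prop) :
    (∃ U ∈ S, Sat P U) ↔ Sat P W ∧ ∃ U ∈ l, Sat P U := by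
  induction l generalizing S with
  | nil =>
    change some [] = some S at h
    obtain rfl := Option.some.inj h
    simp
  | cons U l ih =>
    change Option.rec (restrict n W l) _ (meet U W) = some S at h
    cases hm : meet U W with
    | none =>
      rw [hm] at h
      have := not_sat_of_meet (P := P) hm
      rw [ih h]
      simp only [List.mem_cons, exists_eq_or_imp]
      tauto
    | some J =>
      rw [hm] at h
      change Bool.rec _ _ _ = some S at h
      cases hb : Nat.beq J.length W.length && isPartition n J 0 && isPartition n W 0 with
      | true => rw [hb] at h; simp at h
      | false =>
        rw [hb] at h
        change Option.rec none _ (restrict n W l) = some S at h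
        cases hr : restrict n W l with
        | none => rw [hr] at h; simp at h
        | some S' =>
          rw [hr] at h
          obtain rfl := Option.some.inj h
          have h1 := sat_of_meet (P := P) hm
          have h2 := ih hr
          simp only [List.mem_cons, exists_eq_or_imp, h1, h2]
          tauto

/-- If `W` and its intersection with `U` are partitions with equally many blocks, they have equally
many solutions; hence they have the same solutions and `W` lies in `U`. -/
theorem exists_solutions_subset {n : ℕ} {W : List (ℕ × ℕ)} {l : List (List (ℕ × ℕ))}
    (h : restrict n W l = none) : ∃ U ∈ l, solutions n W ⊆ solutions n U := by
  induction l with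
  | nil => exact absurd (show some [] = none from h) (by simp)
  | cons U l ih =>
    change Option.rec (restrict n W l) _ (meet U W) = none at h
    cases hm : meet U W with
    | none =>
      rw [hm] at h
      obtain ⟨U', hU', hs⟩ := ih h
      exact ⟨U', List.mem_cons_of_mem _ hU', hs⟩
    | some J =>
      rw [hm] at h
      change Bool.rec _ _ _ = none at h
      cases hb : Nat.beq J.length W.length && isPartition n J 0 && isPartition n W 0 with
      | true =>
        simp only [Bool.and_eq_true] at hb
        refine ⟨U, List.mem_cons_self, ?_⟩
        have hJ : solutions n J ⊆ solutions n W := fun s hs => by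
          rw [mem_solutions] at hs ⊢
          exact ⟨hs.1, ((sat_of_meet hm).1 hs.2).2⟩
        have heq := Finset.eq_of_subset_of_card_le hJ (by
          rw [card_solutions hb.1.2, card_solutions hb.2, Nat.eq_of_beq_eq_true hb.1.1])
        rw [← heq]
        intro s hs
        rw [mem_solutions] at hs ⊢
        exact ⟨hs.1, ((sat_of_meet hm).1 hs.2).1⟩
      | false =>
        rw [hb] at h
        change Option.rec none _ (restrict n W l) = none at h
        cases hr : restrict n W l with
        | none =>
          obtain ⟨U', hU', hs⟩ := ih hr
          exact ⟨U', List.mem_cons_of_mem _ hU', hs⟩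
        | some S' => rw [hr] at h; simp at h

/-- The subsets of `{0, …, n - 1}` that satisfy the constraints of some member of a family. -/
noncomputable def unionSolutions (n : ℕ) (l : List (List (ℕ × ℕ))) : Finset (Finset ℕ) :=
  l.toFinset.biUnion (solutions n)

theorem mem_unionSolutions {n : ℕ} {l : List (List (ℕ × ℕ))} {s : Finset ℕ} :
    s ∈ unionSolutions n l ↔ s ⊆ Finset.range n ∧ ∃ U ∈ l, Sat (· ∈ s) U := by
  simp only [unionSolutions, Finset.mem_biUnion, List.mem_toFinset, mem_solutions]
  tauto

/-- The outer induction handles the traces on `W`, the inner one the tail of the list. A `W`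
contained in a later member is dropped. -/
theorem card_unionSolutions {n k N : ℕ} {l : List (List (ℕ × ℕ))}
    (h : unionCount n k l = some N) : (unionSolutions n l).card = N := by
  induction k generalizing l N with
  | zero => exact absurd (show none = some N from h) (by simp)
  | succ k ih =>
    induction l generalizing N with
    | nil =>
      obtain rfl := Option.some.inj (show some 0 = some N from h)
      simp [unionSolutions]
    | cons W l ihl =>
      change Option.rec (unionCount n (k + 1) l) _ (restrict n W l) = some N at h
      cases hr : restrict n W l with
      | none =>
        rw [hr] at h
        rw [← ihl h]
        congr 1
        obtain ⟨U, hU, hs⟩ := exists_solutions_subset hr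
        ext s
        simp only [mem_unionSolutions, List.mem_cons, exists_eq_or_imp]
        have h1 := @hs s
        simp only [mem_solutions] at h1
        constructor
        · rintro ⟨h2, h3 | h3⟩
          · exact ⟨h2, U, hU, (h1 ⟨h2, h3⟩).2⟩
          · exact ⟨h2, h3⟩
        · rintro ⟨h2, h3⟩
          exact ⟨h2, .inr h3⟩
      | some S =>
        rw [hr] at h
        change Bool.rec none (Option.rec none _ (unionCount n k S)) (isPartition n W 0) =
          some N at h
        cases hW : isPartition n W 0 with
        | false => rw [hW] at h; simp at h
        | true =>
          rw [hW] at h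
          cases ha : unionCount n k S with
          | none => rw [ha] at h; simp at h
          | some a =>
            rw [ha] at h
            change Option.rec none _ (unionCount n (k + 1) l) = some N at h
            cases hb : unionCount n (k + 1) l with
            | none => rw [hb] at h; simp at h
            | some b =>
              rw [hb] at h
              obtain rfl := Option.some.inj h
              rw [← ihl hb, ← ih ha, ← card_solutions hW]
              have hS : unionSolutions n S = solutions n W ∩ unionSolutions n l := by
                ext s
                simp only [mem_unionSolutions, Finset.mem_inter, mem_solutions,
                  sat_union_restrict hr]
                tauto
              have hu : unionSolutions n (W :: l) = solutions n W ∪ unionSolutions n l := by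
                ext s
                simp only [mem_unionSolutions, Finset.mem_union, mem_solutions, List.mem_cons,
                  exists_eq_or_imp]
                tauto
              rw [hu, hS]
              have h1 := Finset.card_union_add_card_inter (solutions n W) (unionSolutions n l)
              -- Guarantees that the subtraction of natural numbers in `unionCount` does not
              -- truncate.
              have h2 : (solutions n W ∩ unionSolutions n l).card ≤ (solutions n W).card :=
                Finset.card_le_card Finset.inter_subset_left
              omega

/-! ### Numerical codes of affine maps -/

/-- The pair of natural numbers that represents `e^u.v`. -/
def code {n : ℕ} (g : Aff n) : ℕ × ℕ :=
  ((Multiplicative.toAdd g.left).val, (g.right : ZMod n).val)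

/-- Evaluation of the affine map with a given code. -/
def applyCode (n : ℕ) (g : ℕ × ℕ) (x : ℕ) : ℕ := Nat.mod (Nat.add (Nat.mul g.2 x) g.1) n

/-- Composition of affine maps in terms of codes. -/
def mulCode (n : ℕ) (g h : ℕ × ℕ) : ℕ × ℕ := (applyCode n g h.1, Nat.mod (Nat.mul g.2 h.2) n)

/-- Powers of affine maps in terms of codes. -/
noncomputable def powCode (n : ℕ) (g : ℕ × ℕ) (k : ℕ) : ℕ × ℕ :=
  Nat.rec (0, 1) (fun _ h => mulCode n g h) k

/-- Equality of codes. -/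
def beqCode (g h : ℕ × ℕ) : Bool := Nat.beq g.1 h.1 && Nat.beq g.2 h.2

/-- The position of a code in an enumeration of all codes. -/
def rankCode (n : ℕ) (g : ℕ × ℕ) : ℕ := Nat.add (Nat.mul g.2 n) g.1

/-- The code `g` is nontrivial, its order divides `q`, and it has the least rank among its
nontrivial powers. -/
noncomputable def isTorsionGenerator (n q : ℕ) (g : ℕ × ℕ) : Bool :=
  beqCode (powCode n g q) (0, 1) && !beqCode g (0, 1) && (List.range q).all fun k =>
    beqCode (powCode n g k) (0, 1) || Nat.ble (rankCode n g) (rankCode n (powCode n g k))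

/-- Conjugation by the involution `p` fixes or inverts `g`. -/
def isFixedOrInverted (n : ℕ) (p g : ℕ × ℕ) : Bool :=
  beqCode (mulCode n p (mulCode n g p)) g ||
    beqCode (mulCode n (mulCode n p (mulCode n g p)) g) (0, 1)

/-- Sufficiently many symmetries to detect the sets with polarity `p` that are not rigid. -/
noncomputable def symmetries (n : ℕ) (p : ℕ × ℕ) : List (ℕ × ℕ) :=
  [11, 7, 5, 3, 2].flatMap fun q => (List.range n).reverse.flatMap fun v =>
    bif Nat.beq (Nat.mod (Nat.pow v q) n) 1 then
      ((List.range n).map fun u => (u, v)).filter fun g =>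
        isTorsionGenerator n q g && isFixedOrInverted n p g
    else []

/-- The constraints that express that a set has polarity `p`. -/
def polarityBlocks (n : ℕ) (p : ℕ × ℕ) : List (ℕ × ℕ) :=
  (List.range n).filterMap fun x => bif Nat.blt x (applyCode n p x) then
    some (Nat.pow 2 x, Nat.pow 2 (applyCode n p x)) else none

/-- The constraints that express that a set is invariant under `g`. -/
def invarianceBlocks (n : ℕ) (g : ℕ × ℕ) : List (ℕ × ℕ) :=
  (List.range n).filterMap fun x =>
    bif Nat.ble (applyCode n g x) x && Nat.beq (applyCode n g (applyCode n g x)) x then none else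
    some (Nat.lor (Nat.pow 2 x) (Nat.pow 2 (applyCode n g x)), 0)

/-- The sets with polarity `p` that are not rigid, as a union of families of sets. -/
noncomputable def nonrigidFamilies (n : ℕ) (p : ℕ × ℕ) : List (List (ℕ × ℕ)) :=
  (symmetries n p).filterMap fun g => meet (invarianceBlocks n g) (polarityBlocks n p)

/-- The affine map `p` is an involution without fixed points. -/
def isFreeInvolution (n : ℕ) (p : ℕ × ℕ) : Bool :=
  beqCode (mulCode n p p) (0, 1) && (List.range n).all fun x => !Nat.beq (applyCode n p x) x

/-- All codes of affine maps. -/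
def codes (n : ℕ) : List (ℕ × ℕ) :=
  ((List.range n).filter fun v => Nat.beq (Nat.gcd v n) 1).flatMap fun v =>
    (List.range n).map fun u => (u, v)

/-- The order of the centralizer of `p`. -/
def centralizerOrder (n : ℕ) (p : ℕ × ℕ) : ℕ :=
  (codes n).countP fun g => beqCode (mulCode n p g) (mulCode n g p)

/-- `p` is the code of an affine map. -/
def isCode (n : ℕ) (p : ℕ × ℕ) : Bool :=
  Nat.blt p.1 n && Nat.blt p.2 n && Nat.beq (Nat.gcd p.2 n) 1

/-- There are `N` patterns with polarity `p`. -/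
noncomputable def checkPolarity (n : ℕ) (p : ℕ × ℕ) (N : ℕ) : Bool :=
  isCode n p && isFreeInvolution n p && isPartition n (polarityBlocks n p) 0 &&
    Option.rec false (fun b => Nat.beq (Nat.add (Nat.mul N (centralizerOrder n p)) b)
      (Nat.pow 2 (polarityBlocks n p).length)) (unionCount n n (nonrigidFamilies n p))

/-- Each involution without fixed points is conjugate to a member of the list. -/
def checkClasses (n : ℕ) (l : List (ℕ × ℕ)) : Bool :=
  (codes n).all fun g => !isFreeInvolution n g || l.any fun p => Nat.beq p.2 g.2 &&
    (codes n).any fun h => beqCode (mulCode n h p) (mulCode n g h)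

/-! ### Codes represent affine maps faithfully -/

section

variable {n : ℕ} [NeZero n]

theorem code_lt (g : Aff n) : (code g).1 < n ∧ (code g).2 < n :=
  ⟨ZMod.val_lt _, ZMod.val_lt _⟩

theorem code_injective : Function.Injective (code : Aff n → ℕ × ℕ) := by
  intro g h hgh
  rw [code, code, Prod.mk.injEq] at hgh
  refine SemidirectProduct.ext ?_ ?_
  · exact Multiplicative.toAdd.injective (ZMod.val_injective n hgh.1)
  · exact Units.ext (ZMod.val_injective n hgh.2)

theorem val_affine (v x u : ZMod n) :
    (v * x + u).val = Nat.mod (Nat.add (Nat.mul v.val x.val) u.val) n := by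
  change _ = (v.val * x.val + u.val) % n
  rw [ZMod.val_add, ZMod.val_mul, Nat.mod_add_mod]

theorem val_smul (g : Aff n) (x : ZMod n) : (g • x).val = applyCode n (code g) x.val :=
  val_affine _ _ _

theorem code_mul (g h : Aff n) : code (g * h) = mulCode n (code g) (code h) := by
  rw [code, mulCode, Prod.mk.injEq]
  constructor
  · rw [SemidirectProduct.mul_left, toAdd_mul, toAdd_unitsHom, add_comm]
    exact val_affine _ _ _
  · rw [SemidirectProduct.mul_right, Units.val_mul, ZMod.val_mul]
    rfl

theorem code_one (hn : 1 < n) : code (1 : Aff n) = (0, 1) := by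
  have : Fact (1 < n) := ⟨hn⟩
  rw [code, Prod.mk.injEq, SemidirectProduct.one_left, SemidirectProduct.one_right, toAdd_one,
    Units.val_one, ZMod.val_zero, ZMod.val_one]
  exact ⟨rfl, rfl⟩

theorem code_pow (hn : 1 < n) (g : Aff n) (k : ℕ) : code (g ^ k) = powCode n (code g) k := by
  induction k with
  | zero => exact code_one hn
  | succ k ih => rw [pow_succ', code_mul, ih]; rfl

theorem beqCode_iff {g h : ℕ × ℕ} : beqCode g h = true ↔ g = h := by
  rw [beqCode, Bool.and_eq_true, Nat.beq_eq, Nat.beq_eq, Prod.ext_iff]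

theorem beqCode_code {g h : Aff n} : beqCode (code g) (code h) = true ↔ g = h := by
  rw [beqCode_iff, code_injective.eq_iff]

theorem beqCode_code_one (hn : 1 < n) {g : Aff n} : beqCode (code g) (0, 1) = true ↔ g = 1 := by
  rw [← code_one hn, beqCode_code]

theorem exists_code {u v : ℕ} (hu : u < n) (hv : v < n) (h : v.Coprime n) :
    ∃ g : Aff n, code g = (u, v) := by
  refine ⟨Aff.mk (u : ZMod n) (ZMod.unitOfCoprime v h), ?_⟩
  rw [code, Prod.mk.injEq]
  exact ⟨ZMod.val_cast_of_lt hu, by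
    change ((ZMod.unitOfCoprime v h : (ZMod n)ˣ) : ZMod n).val = v
    rw [ZMod.coe_unitOfCoprime, ZMod.val_cast_of_lt hv]⟩

theorem coprime_code (g : Aff n) : (code g).2.Coprime n := ZMod.val_coe_unit_coprime g.right

theorem mem_codes {c : ℕ × ℕ} : c ∈ codes n ↔ ∃ g : Aff n, code g = c := by
  obtain ⟨u, v⟩ := c
  simp only [codes, List.mem_flatMap, List.mem_filter, List.mem_range, Nat.beq_eq, List.mem_map,
    Prod.mk.injEq]
  constructor
  · rintro ⟨v, ⟨hv, h⟩, u, hu, rfl, rfl⟩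
    exact exists_code hu hv h
  · rintro ⟨g, hg⟩
    have h1 := code_lt g
    have h2 := coprime_code g
    rw [hg] at h1 h2
    exact ⟨v, ⟨h1.2, h2⟩, u, h1.1, rfl, rfl⟩

theorem nodup_codes : (codes n).Nodup := by
  rw [codes, List.nodup_flatMap]
  refine ⟨fun v _ => List.nodup_range.map fun a b hab => (Prod.mk.inj hab).1, ?_⟩
  refine (List.nodup_range.filter _).imp fun {v w} hvw => ?_
  rw [Function.onFun, List.disjoint_left]
  intro c hc hc'
  obtain ⟨_, _, rfl⟩ := List.mem_map.1 hc
  obtain ⟨_, _, h⟩ := List.mem_map.1 hc'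
  exact hvw (Prod.mk.inj h).2.symm

theorem countP_codes (f : ℕ × ℕ → Bool) :
    (codes n).countP f = Nat.card {g : Aff n // f (code g) = true} := by
  classical
  have := Fintype.ofFinite (Aff n)
  rw [List.countP_eq_length_filter, ← List.toFinset_card_of_nodup (nodup_codes.filter f),
    Nat.card_eq_fintype_card, Fintype.card_subtype,
    ← Finset.card_image_of_injective _ (code_injective (n := n))]
  congr 1
  ext c
  simp only [List.mem_toFinset, List.mem_filter, mem_codes, Finset.mem_image, Finset.mem_filter,
    Finset.mem_univ, true_and]
  constructor
  · rintro ⟨⟨g, rfl⟩, h⟩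
    exact ⟨g, h, rfl⟩
  · rintro ⟨g, h, rfl⟩
    exact ⟨⟨g, rfl⟩, h⟩

theorem centralizerOrder_code (p : Aff n) :
    centralizerOrder n (code p) = Nat.card {g : Aff n // p * g = g * p} := by
  rw [centralizerOrder, countP_codes]
  simp only [← code_mul, beqCode_code]

theorem isFreeInvolution_iff (hn : 1 < n) {p : Aff n} :
    isFreeInvolution n (code p) = true ↔ p * p = 1 ∧ ∀ x : ZMod n, p • x ≠ x := by
  rw [isFreeInvolution, Bool.and_eq_true, ← code_mul, beqCode_code_one hn, List.all_eq_true]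
  refine and_congr_right fun _ => ?_
  constructor
  · intro h x hx
    have h1 := h x.val (List.mem_range.2 (ZMod.val_lt x))
    rw [← val_smul, hx, Bool.not_eq_true', ← Bool.not_eq_true, Nat.beq_eq] at h1
    exact h1 rfl
  · intro h i hi
    rw [List.mem_range] at hi
    have h1 := h (i : ZMod n)
    rw [Bool.not_eq_true', ← Bool.not_eq_true, Nat.beq_eq]
    intro h2
    apply h1
    apply ZMod.val_injective n
    rw [val_smul, ZMod.val_cast_of_lt hi, h2]

/-! ### Polarities and symmetries of a set -/

theorem isPolarity_iff {p : Aff n} {X : Finset (ZMod n)} :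
    IsPolarity p X ↔ ∀ x, p • x ∈ X ↔ x ∉ X := by
  rw [IsPolarity, Finset.ext_iff]
  constructor
  · intro h x
    have := h (p • x)
    rw [Finset.smul_mem_smul_finset_iff, Finset.mem_compl] at this
    tauto
  · intro h x
    obtain ⟨y, rfl⟩ := MulAction.surjective p x
    rw [Finset.smul_mem_smul_finset_iff, Finset.mem_compl, h y, not_not]

theorem smul_eq_self_iff {g : Aff n} {X : Finset (ZMod n)} :
    g • X = X ↔ ∀ x, g • x ∈ X ↔ x ∈ X := by
  rw [Finset.ext_iff]
  constructor
  · intro h x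
    have := h (g • x)
    rw [Finset.smul_mem_smul_finset_iff] at this
    exact this.symm
  · intro h x
    obtain ⟨y, rfl⟩ := MulAction.surjective g x
    rw [Finset.smul_mem_smul_finset_iff, h y]

theorem testBit_pow {i j : ℕ} : (Nat.pow 2 i).testBit j = true ↔ i = j := by
  change (2 ^ i).testBit j = true ↔ _
  rw [Nat.testBit_two_pow, decide_eq_true_eq]

theorem holds_pair {P : ℕ → Prop} {i j : ℕ} :
    Holds P (Nat.pow 2 i, Nat.pow 2 j) ↔ (P j ↔ ¬P i) := by
  simp only [Holds, testBit_pow]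
  constructor
  · rintro ⟨t, ht⟩
    have h1 := (ht i).1 rfl
    have h2 := (ht j).2 rfl
    tauto
  · intro h
    refine ⟨P i, fun k => ⟨?_, ?_⟩⟩ <;> rintro rfl <;> tauto

theorem holds_single {P : ℕ → Prop} {i j : ℕ} :
    Holds P (Nat.lor (Nat.pow 2 i) (Nat.pow 2 j), 0) ↔ (P j ↔ P i) := by
  simp only [Holds, testBit_lor, Bool.or_eq_true, testBit_pow]
  constructor
  · rintro ⟨t, ht⟩
    have h1 := (ht i).1 (.inl rfl)
    have h2 := (ht j).1 (.inr rfl)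
    tauto
  · intro h
    refine ⟨P i, fun k => ⟨?_, fun hk => absurd hk (by simp)⟩⟩
    rintro (rfl | rfl) <;> tauto

/-- The representatives in `{0, …, n - 1}` of the elements of a subset of `ℤ_n`. -/
def representatives (X : Finset (ZMod n)) : Finset ℕ := X.image ZMod.val

theorem val_mem_representatives {X : Finset (ZMod n)} {x : ZMod n} :
    x.val ∈ representatives X ↔ x ∈ X :=
  (ZMod.val_injective n).mem_finset_image

/-- Each two-cycle of `p` is listed once, from its smaller point; the condition at the larger point
follows because `p` is an involution. -/
theorem sat_polarityBlocks (hn : 1 < n) {p : Aff n} {X : Finset (ZMod n)}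
    (hp : isFreeInvolution n (code p) = true) :
    Sat (· ∈ representatives X) (polarityBlocks n (code p)) ↔ IsPolarity p X := by
  obtain ⟨hpp, hfree⟩ := (isFreeInvolution_iff hn).1 hp
  rw [isPolarity_iff]
  have key : Sat (· ∈ representatives X) (polarityBlocks n (code p)) ↔
      ∀ x : ZMod n, x.val < (p • x).val → (p • x ∈ X ↔ x ∉ X) := by
    simp only [Sat, polarityBlocks, List.mem_filterMap, List.mem_range]
    constructor
    · intro h x hx
      have h1 := h (Nat.pow 2 x.val, Nat.pow 2 (p • x).val) ⟨x.val, ZMod.val_lt x, by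
        rw [← val_smul, show Nat.blt x.val (p • x).val = true by
          rw [Nat.blt_eq]; exact hx, cond_true]⟩
      rwa [holds_pair, val_mem_representatives, val_mem_representatives] at h1
    · rintro h b ⟨i, hi, hb⟩
      have h0 : ((i : ZMod n)).val = i := ZMod.val_cast_of_lt hi
      have h1 := h (i : ZMod n)
      rw [← h0, ← val_smul] at hb
      cases hlt : Nat.blt (i : ZMod n).val (p • (i : ZMod n)).val with
      | false => rw [hlt] at hb; simp at hb
      | true =>
        rw [hlt] at hb
        obtain rfl := Option.some.inj hb
        rw [holds_pair, val_mem_representatives, val_mem_representatives]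
        exact h1 (by rwa [Nat.blt_eq] at hlt)
  rw [key]
  refine ⟨fun h x => ?_, fun h x _ => h x⟩
  rcases lt_trichotomy x.val (p • x).val with hlt | heq | hgt
  · exact h x hlt
  · exact absurd (ZMod.val_injective n heq).symm (hfree x)
  · have hx : p • p • x = x := by rw [smul_smul, hpp, one_smul]
    have := h (p • x) (by rwa [hx])
    rw [hx] at this
    tauto

theorem sat_invarianceBlocks {g : Aff n} {X : Finset (ZMod n)} :
    Sat (· ∈ representatives X) (invarianceBlocks n (code g)) ↔ g • X = X := by
  rw [smul_eq_self_iff]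
  simp only [Sat, invarianceBlocks, List.mem_filterMap, List.mem_range]
  constructor
  · intro h
    have key : ∀ x : ZMod n, ¬((g • x).val ≤ x.val ∧ g • g • x = x) → (g • x ∈ X ↔ x ∈ X) := by
      intro x hx
      have h1 := h (Nat.lor (Nat.pow 2 x.val) (Nat.pow 2 (g • x).val), 0)
        ⟨x.val, ZMod.val_lt x, by
          rw [← val_smul, ← val_smul, show (Nat.ble (g • x).val x.val &&
            Nat.beq (g • g • x).val x.val) = false by
              rwa [← Bool.not_eq_true, Bool.and_eq_true, Nat.ble_eq, Nat.beq_eq,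
                (ZMod.val_injective n).eq_iff], cond_false]⟩
      rwa [holds_single, val_mem_representatives, val_mem_representatives] at h1
    intro x
    by_cases hx : (g • x).val ≤ x.val ∧ g • g • x = x
    · by_cases hgx : g • x = x
      · rw [hgx]
      -- Of a two-cycle only the larger point is omitted: if both were, their representatives would
      -- coincide.
      · have := key (g • x) fun hc => hgx (ZMod.val_injective n
          (le_antisymm hx.1 ((congrArg ZMod.val hx.2).ge.trans hc.1)))
        rw [hx.2] at this
        exact this.symm
    · exact key x hx
  · rintro h b ⟨i, hi, hb⟩
    have h0 : ((i : ZMod n)).val = i := ZMod.val_cast_of_lt hi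
    rw [← h0, ← val_smul] at hb
    cases hlt : Nat.ble (g • (i : ZMod n)).val (i : ZMod n).val &&
        Nat.beq (applyCode n (code g) (g • (i : ZMod n)).val) (i : ZMod n).val with
    | true => rw [hlt] at hb; simp at hb
    | false =>
      rw [hlt] at hb
      obtain rfl := Option.some.inj hb
      rw [holds_single, val_mem_representatives, val_mem_representatives]
      exact h _

theorem representatives_injective :
    Function.Injective (representatives : Finset (ZMod n) → Finset ℕ) :=
  Finset.image_injective (ZMod.val_injective n)

theorem representatives_subset (X : Finset (ZMod n)) : representatives X ⊆ Finset.range n := by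
  intro i hi
  obtain ⟨x, -, rfl⟩ := Finset.mem_image.1 hi
  exact Finset.mem_range.2 (ZMod.val_lt x)

theorem exists_representatives_eq {s : Finset ℕ} (hs : s ⊆ Finset.range n) :
    ∃ X : Finset (ZMod n), representatives X = s := by
  refine ⟨s.image fun i : ℕ => (i : ZMod n), ?_⟩
  rw [representatives, Finset.image_image]
  refine (Finset.image_congr fun i hi => ?_).trans Finset.image_id
  exact ZMod.val_cast_of_lt (Finset.mem_range.1 (hs hi))

theorem card_representatives_mem (S : Finset (Finset ℕ)) (hS : ∀ s ∈ S, s ⊆ Finset.range n) :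
    {X : Finset (ZMod n) | representatives X ∈ S}.ncard = S.card := by
  rw [← Set.ncard_image_of_injective _ (representatives_injective (n := n)),
    ← Set.ncard_coe_finset S]
  congr 1
  ext s
  simp only [Set.mem_image, Set.mem_ofPred_eq, Finset.mem_coe]
  constructor
  · rintro ⟨X, hX, rfl⟩
    exact hX
  · intro hs
    obtain ⟨X, rfl⟩ := exists_representatives_eq (hS s hs)
    exact ⟨X, hs, rfl⟩

/-! ### Detecting non-rigid sets by symmetries of prime order -/

theorem card_aff : Nat.card (Aff n) = n * n.totient := by
  rw [SemidirectProduct.card, Nat.card_congr (Multiplicative.toAdd (α := ZMod n)), Nat.card_zmod,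
    Nat.card_eq_fintype_card, ZMod.card_units_eq_totient]

theorem conj_mem_stabilizer {p g : Aff n} {X : Finset (ZMod n)} (hp : IsPolarity p X)
    (hg : g • X = X) : (p * g * p) • X = X := by
  rw [isPolarity_iff] at hp
  rw [smul_eq_self_iff] at hg ⊢
  intro x
  rw [mul_smul, mul_smul, hp, hg, hp, not_not]

/-- The symmetry group of a set that is not rigid contains a nontrivial element that is fixed or
inverted by a given polarity. -/
theorem exists_fixed_or_inverted {p : Aff n} {X : Finset (ZMod n)} (hpp : p * p = 1)
    (hp : IsPolarity p X) (hX : ¬IsRigid X) :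
    ∃ g : Aff n, g • X = X ∧ g ≠ 1 ∧ (p * g * p = g ∨ p * g * p = g⁻¹) := by
  obtain ⟨h, hh, h1⟩ : ∃ h : Aff n, h • X = X ∧ h ≠ 1 := by
    rw [IsRigid, Subgroup.eq_bot_iff_forall] at hX
    push Not at hX
    exact hX
  by_cases hfix : ∃ g : Aff n, g • X = X ∧ g ≠ 1 ∧ p * g * p = g
  · obtain ⟨g, hg, hg1, hc⟩ := hfix
    exact ⟨g, hg, hg1, .inl hc⟩
  · let φ : MulAction.stabilizer (Aff n) X →* MulAction.stabilizer (Aff n) X :=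
      MonoidHom.mk' (fun g => ⟨p * g * p, conj_mem_stabilizer hp g.2⟩) fun a b => by
        apply Subtype.ext
        change p * (a * b : Aff n) * p = p * a * p * (p * b * p)
        rw [show p * (a : Aff n) * p * (p * b * p) = p * a * (p * p) * b * p by group, hpp]
        group
    have hφ : MonoidHom.FixedPointFree φ := by
      intro g hg
      by_contra hg1
      exact hfix ⟨g, g.2, fun h => hg1 (Subtype.ext h), congrArg Subtype.val hg⟩
    have hinv : Function.Involutive φ := by
      intro g
      apply Subtype.ext
      change p * (p * g * p) * p = (g : Aff n)
      rw [show p * (p * (g : Aff n) * p) * p = p * p * g * (p * p) by group, hpp, one_mul, mul_one]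
    -- A fixed-point-free involutive automorphism of a finite group is inversion.
    have := congrFun (hφ.coe_eq_inv_of_involutive hinv) ⟨h, hh⟩
    exact ⟨h, hh, h1, .inr (congrArg Subtype.val this)⟩

theorem fixed_or_inverted_pow {p g : Aff n} (hpp : p * p = 1)
    (h : p * g * p = g ∨ p * g * p = g⁻¹) (k : ℕ) :
    p * g ^ k * p = g ^ k ∨ p * g ^ k * p = (g ^ k)⁻¹ := by
  have hp : p = p⁻¹ := eq_inv_of_mul_eq_one_left hpp
  have key : ∀ a : Aff n, p * a * p = p * a * p⁻¹ := fun a => by rw [← hp]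
  rw [key] at h ⊢
  rw [← conj_pow]
  rcases h with h | h
  · left; rw [h]
  · right; rw [h, inv_pow]

theorem isFixedOrInverted_code (hn : 1 < n) {p g : Aff n} :
    isFixedOrInverted n (code p) (code g) = true ↔ p * g * p = g ∨ p * g * p = g⁻¹ := by
  rw [isFixedOrInverted, ← code_mul, ← code_mul, ← code_mul, Bool.or_eq_true, beqCode_code,
    beqCode_code_one hn, ← mul_assoc, mul_eq_one_iff_eq_inv]

theorem val_pow_right (g : Aff n) (k : ℕ) :
    (code (g ^ k)).2 = Nat.mod (Nat.pow (code g).2 k) n := by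
  change ((SemidirectProduct.rightHom (g ^ k) : (ZMod n)ˣ) : ZMod n).val =
    (g.right : ZMod n).val ^ k % n
  rw [map_pow, Units.val_pow_eq_pow_val, ← ZMod.val_natCast, Nat.cast_pow, ZMod.natCast_zmod_val]
  rfl

theorem mem_symmetries {p : ℕ × ℕ} {c : ℕ × ℕ} :
    c ∈ symmetries n p ↔ ∃ q ∈ [11, 7, 5, 3, 2], c.1 < n ∧ c.2 < n ∧
      Nat.mod (Nat.pow c.2 q) n = 1 ∧ isTorsionGenerator n q c = true ∧
        isFixedOrInverted n p c = true := by
  simp only [symmetries, List.mem_flatMap, List.mem_reverse, List.mem_range]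
  refine exists_congr fun q => and_congr_right fun _ => ?_
  constructor
  · rintro ⟨v, hv, hc⟩
    cases hb : Nat.beq (Nat.mod (Nat.pow v q) n) 1 with
    | false => rw [hb] at hc; simp at hc
    | true =>
      rw [hb, cond_true, List.mem_filter, List.mem_map, Bool.and_eq_true] at hc
      obtain ⟨⟨u, hu, rfl⟩, h1, h2⟩ := hc
      exact ⟨List.mem_range.1 hu, hv, Nat.eq_of_beq_eq_true hb, h1, h2⟩
  · rintro ⟨hu, hv, hb, h1, h2⟩
    refine ⟨c.2, hv, ?_⟩
    rw [show Nat.beq (Nat.mod (Nat.pow c.2 q) n) 1 = true by rwa [Nat.beq_eq], cond_true,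
      List.mem_filter, List.mem_map, Bool.and_eq_true]
    exact ⟨⟨c.1, List.mem_range.2 hu, rfl⟩, h1, h2⟩

theorem exists_code_of_mem_symmetries (hn : 1 < n) {p c : ℕ × ℕ} (hc : c ∈ symmetries n p) :
    ∃ g : Aff n, code g = c ∧ g ≠ 1 := by
  obtain ⟨q, hq, hu, hv, hpow, htor, -⟩ := mem_symmetries.1 hc
  have hq0 : 0 < q := by
    rcases List.mem_cons.1 hq with rfl | hq
    · norm_num
    · simp only [List.mem_cons, List.not_mem_nil, or_false] at hq
      omega
  -- The linear part is a unit because its `q`-th power is 1 modulo `n`.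
  have hcop : c.2.Coprime n := by
    rw [← Nat.coprime_pow_left_iff hq0, Nat.coprime_comm, Nat.coprime_iff_gcd_eq_one, Nat.gcd_rec]
    exact (congrArg (Nat.gcd · n) hpow).trans (Nat.gcd_one_left n)
  obtain ⟨g, hg⟩ := exists_code hu hv hcop
  obtain rfl : code g = c := hg
  refine ⟨g, rfl, ?_⟩
  rintro rfl
  rw [isTorsionGenerator, Bool.and_eq_true, Bool.and_eq_true, Bool.not_eq_true',
    ← Bool.not_eq_true, beqCode_code_one hn] at htor
  exact htor.1.2 rfl

/-- Since `2310 = 2 * 3 * 5 * 7 * 11`, the divisibility hypothesis says that a prime order in `Aff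
n` is at most 11; the exponent is just ample. -/
theorem exists_symmetry (hn : 1 < n) (hdvd : n * n.totient ∣ 2310 ^ 10) {p : Aff n}
    {X : Finset (ZMod n)} (hpp : p * p = 1) (hp : IsPolarity p X) (hX : ¬IsRigid X) :
    ∃ g : Aff n, code g ∈ symmetries n (code p) ∧ g • X = X := by
  let T : Set (Aff n) := {g | g • X = X ∧ g ≠ 1 ∧ (p * g * p = g ∨ p * g * p = g⁻¹) ∧
    ∃ q, q.Prime ∧ g ^ q = 1}
  have hT : T.Nonempty := by
    obtain ⟨g, hg, hg1, hc⟩ := exists_fixed_or_inverted hpp hp hX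
    obtain ⟨q, hq, k, hk⟩ := Nat.exists_prime_and_dvd (mt orderOf_eq_one_iff.1 hg1)
    refine ⟨g ^ k, ?_, ?_, fixed_or_inverted_pow hpp hc k, q, hq, ?_⟩
    · exact pow_mem (S := MulAction.stabilizer (Aff n) X) hg k
    · have hpos := orderOf_pos g
      refine pow_ne_one_of_lt_orderOf (by rintro rfl; omega) ?_
      rw [hk]
      have : 0 < k := Nat.pos_of_ne_zero (by rintro rfl; omega)
      have := hq.two_le
      nlinarith
    · rw [← pow_mul, mul_comm, ← hk, pow_orderOf_eq_one]
  -- `T` is closed under nontrivial powers, so an element of least rank in `T` is the generator that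
  -- `isTorsionGenerator` selects in its cyclic group.
  obtain ⟨g, ⟨hg, hg1, hc, q, hq, hgq⟩, hmin⟩ :=
    WellFounded.has_min (measure fun g : Aff n => rankCode n (code g)).wf T hT
  refine ⟨g, mem_symmetries.2 ⟨q, ?_, (code_lt g).1, (code_lt g).2, ?_, ?_,
    (isFixedOrInverted_code hn).2 hc⟩, hg⟩
  · have : Fact q.Prime := ⟨hq⟩
    have h1 : q ∣ 2310 ^ 10 := by
      rw [← orderOf_eq_prime hgq hg1]
      exact ((orderOf_dvd_natCard g).trans (dvd_of_eq card_aff)).trans hdvd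
    have h2 : q ∣ 11 * (7 * (5 * (3 * 2))) := hq.dvd_of_dvd_pow h1
    simp only [hq.dvd_mul, Nat.prime_dvd_prime_iff_eq hq Nat.prime_two,
      Nat.prime_dvd_prime_iff_eq hq Nat.prime_three, Nat.prime_dvd_prime_iff_eq hq Nat.prime_five,
      Nat.prime_dvd_prime_iff_eq hq Nat.prime_seven,
      Nat.prime_dvd_prime_iff_eq hq Nat.prime_eleven] at h2
    simpa using h2
  · rw [← val_pow_right, hgq, code_one hn]
  · rw [isTorsionGenerator, Bool.and_eq_true, Bool.and_eq_true, ← code_pow hn, hgq, code_one hn,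
      Bool.not_eq_true', ← Bool.not_eq_true, beqCode_code_one hn, List.all_eq_true]
    refine ⟨⟨rfl, hg1⟩, fun k _ => ?_⟩
    rw [← code_pow hn, Bool.or_eq_true, beqCode_code_one hn, Nat.ble_eq]
    by_cases hk : g ^ k = 1
    · exact .inl hk
    · refine .inr (not_lt.1 (hmin (g ^ k) ⟨?_, hk, fixed_or_inverted_pow hpp hc k, q, hq, ?_⟩))
      · exact pow_mem (S := MulAction.stabilizer (Aff n) X) hg k
      · rw [← pow_mul, mul_comm, pow_mul, hgq, one_pow]

theorem sat_nonrigidFamilies (hn : 1 < n) (hdvd : n * n.totient ∣ 2310 ^ 10) {p : Aff n}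
    {X : Finset (ZMod n)} (hp : isFreeInvolution n (code p) = true) :
    (∃ W ∈ nonrigidFamilies n (code p), Sat (· ∈ representatives X) W) ↔
      IsPolarity p X ∧ ¬IsRigid X := by
  have key : (∃ W ∈ nonrigidFamilies n (code p), Sat (· ∈ representatives X) W) ↔
      ∃ c ∈ symmetries n (code p), Sat (· ∈ representatives X) (invarianceBlocks n c) ∧
        Sat (· ∈ representatives X) (polarityBlocks n (code p)) := by
    simp only [nonrigidFamilies, List.mem_filterMap]
    constructor
    · rintro ⟨W, ⟨c, hc, hW⟩, hs⟩
      exact ⟨c, hc, (sat_of_meet hW).1 hs⟩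
    · rintro ⟨c, hc, hs⟩
      obtain ⟨W, hW, hs'⟩ := (sat_meet _ _).1 hs
      exact ⟨W, ⟨c, hc, hW⟩, hs'⟩
  rw [key]
  constructor
  · rintro ⟨c, hc, h1, h2⟩
    obtain ⟨g, rfl, hg⟩ := exists_code_of_mem_symmetries hn hc
    rw [sat_invarianceBlocks] at h1
    refine ⟨(sat_polarityBlocks hn hp).1 h2, fun hr => hg ?_⟩
    rw [IsRigid, Subgroup.eq_bot_iff_forall] at hr
    exact hr g h1
  · rintro ⟨hpol, hr⟩
    obtain ⟨g, hg, hgX⟩ := exists_symmetry hn hdvd ((isFreeInvolution_iff hn).1 hp).1 hpol hr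
    exact ⟨code g, hg, sat_invarianceBlocks.2 hgX, (sat_polarityBlocks hn hp).2 hpol⟩

theorem ncard_rigid_of_checkPolarity (hn : 1 < n) (hdvd : n * n.totient ∣ 2310 ^ 10) {p : Aff n}
    {N : ℕ} (h : checkPolarity n (code p) N = true) :
    {X : Finset (ZMod n) | IsPolarity p X ∧ IsRigid X}.ncard =
      N * Nat.card {g : Aff n // p * g = g * p} := by
  simp only [checkPolarity, Bool.and_eq_true] at h
  obtain ⟨⟨⟨-, hp⟩, hpart⟩, h⟩ := h
  cases hb : unionCount n n (nonrigidFamilies n (code p)) with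
  | none => rw [hb] at h; simp at h
  | some b =>
    rw [hb] at h
    have h' : N * centralizerOrder n (code p) + b = 2 ^ (polarityBlocks n (code p)).length :=
      Nat.eq_of_beq_eq_true h
    rw [centralizerOrder_code, ← card_solutions hpart, ← card_unionSolutions hb,
      ← card_representatives_mem (n := n) _ fun s hs => (mem_solutions.1 hs).1,
      ← card_representatives_mem (n := n) _ fun s hs => (mem_unionSolutions.1 hs).1] at h'
    simp only [mem_solutions, mem_unionSolutions, representatives_subset, true_and,
      sat_polarityBlocks hn hp, sat_nonrigidFamilies hn hdvd hp] at h'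
    -- The total `2 ^ k` splits into rigid and non-rigid sets; the latter number `b`.
    have hu : {X : Finset (ZMod n) | IsPolarity p X} =
        {X | IsPolarity p X ∧ IsRigid X} ∪ {X | IsPolarity p X ∧ ¬IsRigid X} := by
      ext X
      simp only [Set.mem_ofPred_eq, Set.mem_union]
      tauto
    rw [hu, Set.ncard_union_eq (Set.disjoint_left.2 fun X h1 h2 => h2.2 h1.2)] at h'
    omega

/-! ### From rigid sets to patterns -/

theorem isStrong_of_isPolarity {p : Aff n} {X : Finset (ZMod n)} (hp : IsPolarity p X)
    (hX : IsRigid X) : IsStrong X := by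
  refine ⟨?_, ⟨p, hp⟩, hX⟩
  have h1 : X.card = Xᶜ.card := by rw [← hp, Finset.card_smul_finset]
  have h2 := Finset.card_add_card_compl X
  rw [ZMod.card] at h2
  rw [IsDichotomy]
  omega

theorem IsRigid.smul {X : Finset (ZMod n)} (hX : IsRigid X) (g : Aff n) : IsRigid (g • X) := by
  rw [IsRigid, MulAction.stabilizer_smul_eq_stabilizer_map_conj, hX, Subgroup.map_bot]

theorem IsRigid.eq_of_smul_eq {X : Finset (ZMod n)} (hX : IsRigid X) {g h : Aff n}
    (hgh : g • X = h • X) : g = h := by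
  have h1 : h⁻¹ * g ∈ MulAction.stabilizer (Aff n) X := by
    rw [MulAction.mem_stabilizer_iff, mul_smul, inv_smul_eq_iff, hgh]
  rw [hX, Subgroup.mem_bot] at h1
  exact (inv_mul_eq_one.1 h1).symm

theorem IsRigid.polarity_unique {X : Finset (ZMod n)} (hX : IsRigid X) {p q : Aff n}
    (hp : IsPolarity p X) (hq : IsPolarity q X) : p = q :=
  hX.eq_of_smul_eq (hp.trans hq.symm)

theorem pattern_eq_iff {X Y : Finset (ZMod n)} :
    pattern X = pattern Y ↔ ∃ g : Aff n, g • Y = X := by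
  rw [pattern, pattern, Quotient.eq]
  exact MulAction.orbitRel_apply

theorem pattern_smul (g : Aff n) (X : Finset (ZMod n)) : pattern (g • X) = pattern X :=
  pattern_eq_iff.2 ⟨g, rfl⟩

/-- The polarity of a rigid set is an involution without fixed points. -/
theorem isFreeInvolution_of_isPolarity (hn : 1 < n) {p : Aff n} {X : Finset (ZMod n)}
    (hp : IsPolarity p X) (hX : IsRigid X) : isFreeInvolution n (code p) = true := by
  rw [isFreeInvolution_iff hn]
  rw [isPolarity_iff] at hp
  constructor
  · apply hX.eq_of_smul_eq
    rw [one_smul, smul_eq_self_iff]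
    intro x
    rw [mul_smul, hp, hp, not_not]
  · intro x hx
    have := hp x
    rw [hx] at this
    tauto

open Classical in
-- The polarity of `g • X` is `g * p * g⁻¹`, so a pattern meets the rigid sets with polarity `p` in
-- one orbit of the centralizer of `p`, and rigidity makes that action free.
theorem ncard_strongPatternsWithPolarity (p : Aff n) :
    {X : Finset (ZMod n) | IsPolarity p X ∧ IsRigid X}.ncard =
      (strongPatternsWithPolarity n (ConjClasses.mk p)).ncard *
        Nat.card {g : Aff n // p * g = g * p} := by
  have := Fintype.ofFinite (Aff n)
  set S : Finset (Finset (ZMod n)) := Finset.univ.filter fun X => IsPolarity p X ∧ IsRigid X with hS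
  have h1 : {X : Finset (ZMod n) | IsPolarity p X ∧ IsRigid X} = ↑S := by
    ext X
    simp [hS]
  have h2 : strongPatternsWithPolarity n (ConjClasses.mk p) = ↑(S.image pattern) := by
    ext P
    simp only [strongPatternsWithPolarity, Set.mem_ofPred_eq, Finset.coe_image, Set.mem_image,
      ← h1]
    constructor
    · rintro ⟨X, hX, rfl, q, hq, hqp⟩
      obtain ⟨g, rfl⟩ := isConj_iff.1 (ConjClasses.mk_eq_mk_iff_isConj.1 hqp)
      exact ⟨g • X, ⟨hq.smul g, hX.2.2.smul g⟩, pattern_smul g X⟩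
    · rintro ⟨X, ⟨hp, hX⟩, rfl⟩
      exact ⟨X, isStrong_of_isPolarity hp hX, rfl, p, hp, rfl⟩
  rw [h1, h2, Set.ncard_coe_finset, Set.ncard_coe_finset, Finset.card_eq_sum_card_image pattern S,
    ← smul_eq_mul, ← Finset.sum_const]
  refine Finset.sum_congr rfl fun P hP => ?_
  obtain ⟨X, hX, rfl⟩ := Finset.mem_image.1 hP
  obtain ⟨-, hp, hr⟩ := Finset.mem_filter.1 hX
  rw [Nat.card_eq_fintype_card, Fintype.card_subtype,
    ← Finset.card_image_of_injective _ fun g h hgh => hr.eq_of_smul_eq hgh]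
  congr 1
  ext Y
  simp only [hS, Finset.mem_filter, Finset.mem_univ, true_and, Finset.mem_image, pattern_eq_iff]
  constructor
  · rintro ⟨⟨hY, hrY⟩, g, rfl⟩
    refine ⟨g, ?_, rfl⟩
    rw [← mul_inv_eq_iff_eq_mul.1 (hrY.polarity_unique (hp.smul g) hY)]
  · rintro ⟨g, hg, rfl⟩
    refine ⟨⟨?_, hr.smul g⟩, g, rfl⟩
    have := hp.smul g
    rwa [← hg, mul_inv_cancel_right] at this

/-- The group of units is commutative, so conjugation does not change linear parts. -/
theorem right_eq_of_mk_eq {p q : Aff n} (h : ConjClasses.mk p = ConjClasses.mk q) :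
    p.right = q.right := by
  obtain ⟨g, rfl⟩ := isConj_iff.1 (ConjClasses.mk_eq_mk_iff_isConj.1 h)
  rw [SemidirectProduct.mul_right, SemidirectProduct.mul_right, SemidirectProduct.inv_right,
    mul_comm g.right, mul_inv_cancel_right]

theorem mem_polarities_iff {c : ConjClasses (Aff n)} :
    c ∈ polarities n ↔ (strongPatternsWithPolarity n c).ncard ≠ 0 := by
  rw [Ne, Set.ncard_eq_zero (Set.toFinite _), ← Ne, ← Set.nonempty_iff_ne_empty]
  constructor
  · rintro ⟨X, hX, h⟩
    exact ⟨pattern X, X, hX, rfl, h⟩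
  · rintro ⟨P, X, hX, -, h⟩
    exact ⟨X, hX, h⟩

/-- The polarity class is determined by the pattern, so patterns with different polarities are
disjoint families. -/
theorem strongCount_eq_sum : strongCount n = (polarityCounts n).sum := by
  classical
  have h1 : strongPatterns n = ↑((polarities n).toFinite.toFinset.biUnion fun c =>
      (strongPatternsWithPolarity n c).toFinite.toFinset) := by
    ext P
    simp only [strongPatterns, Set.mem_ofPred_eq, Finset.coe_biUnion, Set.Finite.coe_toFinset,
      Set.mem_iUnion, exists_prop]
    constructor
    · rintro ⟨X, hX, rfl⟩
      obtain ⟨p, hp⟩ := hX.2.1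
      exact ⟨ConjClasses.mk p, ⟨X, hX, p, hp, rfl⟩, X, hX, rfl, p, hp, rfl⟩
    · rintro ⟨c, -, X, hX, hP, -⟩
      exact ⟨X, hX, hP⟩
  rw [strongCount, h1, Set.ncard_coe_finset, Finset.card_biUnion]
  · rw [polarityCounts]
    refine Finset.sum_congr rfl fun c _ => ?_
    rw [Set.ncard_eq_toFinset_card _ (Set.toFinite _)]
  · intro c _ d _ hcd
    rw [Function.onFun, Finset.disjoint_left]
    intro P hP hP'
    rw [Set.Finite.mem_toFinset] at hP hP'
    obtain ⟨X, hX, rfl, p, hp, rfl⟩ := hP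
    obtain ⟨Y, hY, hXY, q, hq, rfl⟩ := hP'
    obtain ⟨g, rfl⟩ := pattern_eq_iff.1 hXY
    apply hcd
    rw [ConjClasses.mk_eq_mk_iff_isConj, isConj_iff]
    exact ⟨g, hY.2.2.polarity_unique (hp.smul g) hq⟩

/-- The numbers of patterns from numerically verified data: `l` lists the codes of representatives
of the conjugacy classes of involutions without fixed points, with the numbers of patterns. -/
theorem counts_of_check (hn : 1 < n) (hdvd : n * n.totient ∣ 2310 ^ 10) (l : List ((ℕ × ℕ) × ℕ))
    (hclasses : checkClasses n (l.map Prod.fst) = true)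
    (hcheck : (l.all fun r => checkPolarity n r.1 r.2) = true)
    (hnd : (l.map fun r => r.1.2).Nodup) :
    polarityCounts n = ↑((l.map Prod.snd).filter (· ≠ 0)) ∧
      strongCount n = (l.map Prod.snd).sum ∧
      ∀ c, c ∈ polarities n →
        ∃ r ∈ l, r.2 ≠ 0 ∧ ∃ p : Aff n, code p = r.1 ∧ c = ConjClasses.mk p := by
  classical
  have hl := List.all_eq_true.1 hcheck
  obtain ⟨f, hf⟩ : ∃ f : ℕ × ℕ → Aff n, ∀ r ∈ l, code (f r.1) = r.1 := by
    refine ⟨Function.invFun code, fun r hr => Function.invFun_eq ?_⟩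
    have h := hl r hr
    simp only [checkPolarity, isCode, Bool.and_eq_true, Nat.blt_eq, Nat.beq_eq] at h
    exact exists_code h.1.1.1.1.1 h.1.1.1.1.2 h.1.1.1.2
  have hcount : ∀ r ∈ l,
      (strongPatternsWithPolarity n (ConjClasses.mk (f r.1))).ncard = r.2 := by
    intro r hr
    have h := hl r hr
    rw [← hf r hr] at h
    have h1 := ncard_rigid_of_checkPolarity hn hdvd h
    rw [ncard_strongPatternsWithPolarity] at h1
    have : Nonempty {g : Aff n // f r.1 * g = g * f r.1} := ⟨⟨1, by rw [mul_one, one_mul]⟩⟩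
    exact Nat.eq_of_mul_eq_mul_right Nat.card_pos h1
  have hcover : ∀ c ∈ polarities n, ∃ r ∈ l, r.2 ≠ 0 ∧ c = ConjClasses.mk (f r.1) := by
    intro c hc
    obtain ⟨X, hX, p, hp, rfl⟩ := id hc
    have h1 := List.all_eq_true.1 hclasses (code p) (mem_codes.2 ⟨p, rfl⟩)
    rw [isFreeInvolution_of_isPolarity hn hp hX.2.2, Bool.not_true, Bool.false_or,
      List.any_eq_true] at h1
    obtain ⟨q, hq, h2⟩ := h1
    obtain ⟨r, hr, rfl⟩ := List.mem_map.1 hq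
    rw [Bool.and_eq_true, List.any_eq_true] at h2
    obtain ⟨-, d, hd, h3⟩ := h2
    obtain ⟨h, rfl⟩ := mem_codes.1 hd
    rw [← hf r hr, ← code_mul, ← code_mul, beqCode_code] at h3
    have hmk : ConjClasses.mk p = ConjClasses.mk (f r.1) := by
      rw [eq_comm, ConjClasses.mk_eq_mk_iff_isConj, isConj_iff]
      exact ⟨h, mul_inv_eq_iff_eq_mul.2 h3⟩
    refine ⟨r, hr, ?_, hmk⟩
    rw [mem_polarities_iff, hmk, hcount r hr] at hc
    exact hc
  have hpc : polarityCounts n = ↑((l.map Prod.snd).filter (· ≠ 0)) := by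
    set l' := l.filter fun r => r.2 ≠ 0 with hl'
    have hmem : ∀ r ∈ l', r ∈ l ∧ r.2 ≠ 0 := fun r hr => by simpa [hl'] using hr
    -- The listed linear parts are pairwise distinct, hence so are the conjugacy classes. Entries
    -- with count 0 are left out: they are not polarities.
    have hnd' : (l'.map fun r => ConjClasses.mk (f r.1)).Nodup := by
      have h1 : (l'.map fun r => r.1.2).Nodup := hnd.sublist ((List.filter_sublist).map _)
      have hsurj : Function.Surjective (ConjClasses.mk : Aff n → ConjClasses (Aff n)) :=
        ConjClasses.exists_rep
      refine List.Nodup.of_map (fun c => ((Function.surjInv hsurj c).right : ZMod n).val) ?_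
      rw [List.map_map]
      convert h1 using 1
      refine List.map_congr_left fun r hr => ?_
      rw [Function.comp_apply, right_eq_of_mk_eq (Function.surjInv_eq hsurj _)]
      exact congrArg Prod.snd (hf r (hmem r hr).1)
    have hset : (polarities n).toFinite.toFinset =
        (l'.map fun r => ConjClasses.mk (f r.1)).toFinset := by
      ext c
      rw [Set.Finite.mem_toFinset, List.mem_toFinset, List.mem_map]
      constructor
      · intro hc
        obtain ⟨r, hr, h0, rfl⟩ := hcover c hc
        exact ⟨r, by simp [hl', hr, h0], rfl⟩
      · rintro ⟨r, hr, rfl⟩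
        rw [mem_polarities_iff, hcount r (hmem r hr).1]
        exact (hmem r hr).2
    rw [polarityCounts, hset, List.toFinset_val, hnd'.dedup, Multiset.map_coe, List.map_map,
      List.filter_map]
    exact congrArg _ (List.map_congr_left fun r hr => hcount r (hmem r hr).1)
  refine ⟨hpc, ?_, fun c hc => ?_⟩
  · rw [strongCount_eq_sum, hpc, Multiset.sum_coe]
    induction l.map Prod.snd with
    | nil => rfl
    | cons a l ih =>
      by_cases ha : a = 0
      · simpa [ha] using ih
      · simpa [ha] using ih
  · obtain ⟨r, hr, h0, h⟩ := hcover c hc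
    exact ⟨r, hr, h0, f r.1, hf r hr, h⟩

end

/-! ### The table -/

theorem counts_six : polarityCounts 6 = {1} ∧ strongCount 6 = 1 := by
  obtain ⟨h1, h2, -⟩ := counts_of_check (n := 6) (by decide) (by decide +kernel)
    [((1, 5), 1), ((3, 1), 0)]
    (by decide +kernel) (by decide +kernel) (by decide)
  exact ⟨h1, h2⟩

theorem counts_eight : polarityCounts 8 = {1} ∧ strongCount 8 = 1 ∧
    polarities 8 = {ConjClasses.mk (Aff.mk (5 : ZMod 8) (-1))} := by
  obtain ⟨h1, h2, h3⟩ := counts_of_check (n := 8) (by decide) (by decide +kernel)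
    [((5, 7), 1), ((4, 1), 0)] (by decide +kernel) (by decide +kernel) (by decide)
  refine ⟨h1, h2, Set.eq_singleton_iff_nonempty_unique_mem.2 ⟨?_, fun c hc => ?_⟩⟩
  · obtain ⟨P, hP⟩ := Set.ncard_eq_one.1 h2
    obtain ⟨X, hX, -⟩ : P ∈ strongPatterns 8 := hP ▸ Set.mem_singleton P
    obtain ⟨p, hp⟩ := hX.2.1
    exact ⟨ConjClasses.mk p, X, hX, p, hp, rfl⟩
  · obtain ⟨r, hr, h0, p, hp, rfl⟩ := h3 c hc
    -- The other class, that of translation by 4, has count 0; and 7 represents `-1`.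
    have hr' : r.1 = (5, 7) := by
      rcases List.mem_pair.1 hr with rfl | rfl
      · rfl
      · exact absurd rfl h0
    exact congrArg _ (code_injective ((hp.trans hr').trans rfl))

theorem counts_twelve : polarityCounts 12 = {2, 4} ∧ strongCount 12 = 6 := by
  obtain ⟨h1, h2, -⟩ := counts_of_check (n := 12) (by decide) (by decide +kernel)
    [((2, 5), 2), ((1, 11), 4), ((6, 1), 0), ((3, 7), 0)]
    (by decide +kernel) (by decide +kernel) (by decide)
  exact ⟨h1, h2⟩

theorem counts_sixteen : polarityCounts 16 = {1, 14} ∧ strongCount 16 = 15 := by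
  obtain ⟨h1, h2, -⟩ := counts_of_check (n := 16) (by decide) (by decide +kernel)
    [((8, 1), 1), ((1, 15), 14)]
    (by decide +kernel) (by decide +kernel) (by decide)
  exact ⟨h1, h2⟩

theorem counts_twenty : polarityCounts 20 = {3, 6, 54, 27} ∧ strongCount 20 = 90 := by
  obtain ⟨h1, h2, -⟩ := counts_of_check (n := 20) (by decide) (by decide +kernel)
    [((10, 1), 3), ((5, 11), 6), ((1, 19), 54), ((2, 9), 27)]
    (by decide +kernel) (by decide +kernel) (by decide)
  exact ⟨h1, h2⟩

theorem counts_twentyFour : polarityCounts 24 = {14, 54, 63, 228} ∧ strongCount 24 = 359 := by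
  obtain ⟨h1, h2, -⟩ := counts_of_check (n := 24) (by decide) (by decide +kernel)
    [((12, 1), 14), ((4, 17), 54), ((3, 7), 63), ((1, 23), 228)]
    (by decide +kernel) (by decide +kernel) (by decide)
  exact ⟨h1, h2⟩

theorem counts_twentyEight : polarityCounts 28 = {38, 76, 326, 652} ∧ strongCount 28 = 1092 := by
  obtain ⟨h1, h2, -⟩ := counts_of_check (n := 28) (by decide) (by decide +kernel)
    [((14, 1), 38), ((7, 15), 76), ((2, 13), 326), ((1, 27), 652)]
    (by decide +kernel) (by decide +kernel) (by decide)
  exact ⟨h1, h2⟩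

theorem counts_thirtyTwo : polarityCounts 32 = {120, 2032} ∧ strongCount 32 = 2152 := by
  obtain ⟨h1, h2, -⟩ := counts_of_check (n := 32) (by decide) (by decide +kernel)
    [((16, 1), 120), ((1, 31), 2032)]
    (by decide +kernel) (by decide +kernel) (by decide)
  exact ⟨h1, h2⟩

theorem counts_thirtySix : polarityCounts 36 = {560, 1120, 5382, 10764} ∧
    strongCount 36 = 17826 := by
  obtain ⟨h1, h2, -⟩ := counts_of_check (n := 36) (by decide) (by decide +kernel)
    [((18, 1), 560), ((9, 19), 1120), ((2, 17), 5382), ((1, 35), 10764)]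
    (by decide +kernel) (by decide +kernel) (by decide)
  exact ⟨h1, h2⟩

theorem counts_forty : polarityCounts 40 = {1572, 6357, 8100, 32520} ∧
    strongCount 40 = 48549 := by
  obtain ⟨h1, h2, -⟩ := counts_of_check (n := 40) (by decide) (by decide +kernel)
    [((20, 1), 1572), ((5, 31), 6357), ((4, 9), 8100), ((1, 39), 32520)]
    (by decide +kernel) (by decide +kernel) (by decide)
  exact ⟨h1, h2⟩

theorem counts_fortyTwo : polarityCounts 42 = {3936, 12135, 28320, 86448} ∧
    strongCount 42 = 130839 := by
  obtain ⟨h1, h2, -⟩ := counts_of_check (n := 42) (by decide) (by decide +kernel)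
    [((21, 1), 3936), ((7, 29), 12135),
      ((3, 13), 28320), ((1, 41), 86448)]
    (by decide +kernel) (by decide +kernel) (by decide)
  exact ⟨h1, h2⟩

theorem counts_fortyFour : polarityCounts 44 = {4662, 9324, 52278, 104556} ∧
    strongCount 44 = 170820 := by
  obtain ⟨h1, h2, -⟩ := counts_of_check (n := 44) (by decide) (by decide +kernel)
    [((22, 1), 4662), ((11, 23), 9324),
      ((2, 21), 52278), ((1, 43), 104556)]
    (by decide +kernel) (by decide +kernel) (by decide)
  exact ⟨h1, h2⟩

theorem counts_fortyEight : polarityCounts 48 = {21435, 65040, 172410, 521760} ∧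
    strongCount 48 = 780645 := by
  obtain ⟨h1, h2, -⟩ := counts_of_check (n := 48) (by decide) (by decide +kernel)
    [((24, 1), 21435), ((8, 17), 65040),
      ((3, 31), 172410), ((1, 47), 521760)]
    (by decide +kernel) (by decide +kernel) (by decide)
  exact ⟨h1, h2⟩

end StrongDichotomy

open StrongDichotomy in
theorem mainTheorem1 :
    (polarityCounts 6 = {1} ∧ strongCount 6 = 1) ∧
    (polarityCounts 8 = {1} ∧ strongCount 8 = 1 ∧
      polarities 8 = {ConjClasses.mk (Aff.mk (5 : ZMod 8) (-1))}) ∧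
    (polarityCounts 12 = {2, 4} ∧ strongCount 12 = 6) ∧
    (polarityCounts 16 = {1, 14} ∧ strongCount 16 = 15) ∧
    (polarityCounts 20 = {3, 6, 54, 27} ∧ strongCount 20 = 90) ∧
    (polarityCounts 24 = {14, 54, 63, 228} ∧ strongCount 24 = 359) ∧
    (polarityCounts 28 = {38, 76, 326, 652} ∧ strongCount 28 = 1092) ∧
    (polarityCounts 32 = {120, 2032} ∧ strongCount 32 = 2152) ∧
    (polarityCounts 36 = {560, 1120, 5382, 10764} ∧ strongCount 36 = 17826) ∧
    (polarityCounts 40 = {1572, 6357, 8100, 32520} ∧ strongCount 40 = 48549) ∧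
    (polarityCounts 42 = {3936, 12135, 28320, 86448} ∧ strongCount 42 = 130839) ∧
    (polarityCounts 44 = {4662, 9324, 52278, 104556} ∧ strongCount 44 = 170820) ∧
    (polarityCounts 48 = {21435, 65040, 172410, 521760} ∧ strongCount 48 = 780645) :=
  ⟨counts_six, counts_eight, counts_twelve, counts_sixteen, counts_twenty, counts_twentyFour,
    counts_twentyEight, counts_thirtyTwo, counts_thirtySix, counts_forty, counts_fortyTwo,
    counts_fortyFour, counts_fortyEight⟩
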